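/- Let $X$ be a metric space equipped with a $\sigma$-algebra containing all open sets, and let $\mu$ be a probability measure on it such that $\mu(U)>0$ for every nonempty open set $U\subseteq X$. Let $(T_t)_{t\in\mathbb R}$ be an ergodic flow on $(X,\mu)$: $T_0=\mathrm{id}$ and $T_{t+s}=T_tT_s$, the map $(t,x)\mapsto T_tx$ is measurable on $\mathbb R\times X$, every $T_t$ preserves $\mu$, and every measurable set $B$ with $\mu(T_t^{-1}B\,\triangle\,B)=0$ for all $t\in\mathbb R$ satisfies $\mu(B)\in\{0,1\}$. Let $f:X\to\mathbb R$ be $\mu$-integrable with $\int_X f\,d\mu=0$, and suppose that for $\mu$-almost every $x$ the integrals $\sigma(t,x)=\int_0^t f(T_sx)\,ds$ exist (as Lebesgue integrals) for all $t\in\mathbb R$ and depend continuously on $t$. Then for $\mu$-almost every $x$ with $f(x)\ne 0$ there is a sequence of real numbers $t_k\to+\infty$ such that $\sigma(t_k,x)=0$ for all $k$ and $T_{t_k}x\to x$ as $k\to\infty$. -/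

import Mathlib

open MeasureTheory Filter
open scoped Topology

/-- For a flow `t ↦ (t +ᵥ ·)` on `X` (an action of the additive group `ℝ`) and `f : X → ℝ`,
the cocycle `σ(t, x) = ∫₀ᵗ f(T_s x) ds`. -/
noncomputable def flowIntegral {X : Type*} [AddAction ℝ X] (f : X → ℝ) (t : ℝ) (x : X) : ℝ :=
  ∫ s in (0 : ℝ)..t, f (s +ᵥ x)

open Set
open scoped ENNReal

/-! ### Change of variables along an injective primitive. -/

section Real

/-! The core is a counting argument. Suppose points of `B` return to `B` at zeros of `σ` only after
times in `[ε, N]`. Sample an orbit on `n` windows of length `ε` whose starts are `N + ε` apart: two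
sampled times differ by less than `ε` or more than `N`, so `σ` is injective on the sampled visits to
`B`. The integral of `|f|` over these visits is then the length of a set of values of `σ`, hence at
most `2 sup |σ|`. Averaged over `x`, the left side is `n ε ∫_B |f|`. The right side is `o(n)`,
because ergodicity makes a mean-zero `f` an `L¹`-limit of functions with bounded orbit integrals. So
`f = 0` almost everywhere on `B` (`setLIntegral_enorm_eq_zero_of_no_return`).

Where `f ≠ 0`, zeros of `σ` along an orbit are isolated for almost every point, so such points lie
in some `noPastZero f ε`. This supplies the lower bound `ε` on return times; discarding the points
that return after time `N` supplies the upper one (`ae_exists_return`). Applying this to countably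
many balls gives recurrence, since `X` turns out to be second countable. -/

theorem MeasureTheory.LocallyIntegrable.intervalIntegrable_real {φ : ℝ → ℝ}
    (hφ : LocallyIntegrable φ volume) (a b : ℝ) : IntervalIntegrable φ volume a b :=
  (hφ.integrableOn_isCompact isCompact_uIcc).intervalIntegrable

/-- If the primitive of `φ` is injective on `V`, then the integral of `|φ|` over `V` is at most
twice any bound for the primitive on `V`. -/
theorem setLIntegral_enorm_le_of_injOn_primitive {φ : ℝ → ℝ} (hφ : LocallyIntegrable φ volume)
    {V : Set ℝ} (hV : MeasurableSet V)
    (hinj : InjOn (fun t => ∫ s in (0 : ℝ)..t, φ s) V) {M : ℝ≥0∞}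
    (hM : ∀ t ∈ V, ‖∫ s in (0 : ℝ)..t, φ s‖ₑ ≤ M) :
    ∫⁻ t in V, ‖φ t‖ₑ ≤ 2 * M := by
  rcases eq_or_ne M ∞ with rfl | hMtop
  · simp
  have hder := LocallyIntegrable.ae_hasDerivAt_integral hφ
  obtain ⟨D, hDsub, hDm, hD0⟩ := exists_measurable_superset_of_null (ae_iff.1 hder)
  have hD : ∀ t ∉ D, HasDerivAt (fun t => ∫ s in (0 : ℝ)..t, φ s) (φ t) t := fun t ht => by
    by_contra h
    exact ht (hDsub fun h' => h (h' 0))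
  have hVD : ∫⁻ t in V, ‖φ t‖ₑ = ∫⁻ t in V \ D, ‖φ t‖ₑ := by
    refine setLIntegral_congr ?_
    exact (sdiff_null_ae_eq_self hD0).symm
  -- One-dimensional area formula: off the null set `D` the primitive is differentiable with
  -- derivative `φ`, and injectivity rules out multiplicity.
  have key := lintegral_image_eq_lintegral_abs_deriv_mul (hV.diff hDm)
    (fun t ht => (hD t ht.2).hasDerivWithinAt) (hinj.mono sdiff_subset) (fun _ => 1)
  simp only [lintegral_one, Measure.restrict_apply_univ, mul_one] at key
  rw [hVD]
  simp only [Real.enorm_eq_ofReal_abs]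
  rw [← key]
  calc volume ((fun t => ∫ s in (0 : ℝ)..t, φ s) '' (V \ D))
      ≤ volume (Metric.closedBall (0 : ℝ) M.toReal) := by
        refine measure_mono ?_
        rintro _ ⟨t, ht, rfl⟩
        have := hM t ht.1
        rw [mem_closedBall_zero_iff, ← toReal_enorm]
        exact ENNReal.toReal_mono hMtop this
    _ = 2 * M := by
        rw [Real.volume_closedBall, ENNReal.ofReal_mul (by norm_num), ENNReal.ofReal_toReal hMtop]
        simp

end Real

/-! ### Fubini along orbits and the cocycle identity. -/

section Flow

variable {X : Type*} [AddAction ℝ X]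

section Fubini

variable [MeasurableSpace X] [MeasurableVAdd₂ ℝ X]

theorem lintegral_setLIntegral_vadd (μ : Measure X) [SFinite μ] [VAddInvariantMeasure ℝ X μ]
    {g : X → ℝ≥0∞} (hg : Measurable g) (E : Set ℝ) :
    ∫⁻ x, (∫⁻ t in E, g (t +ᵥ x)) ∂μ = volume E * ∫⁻ x, g x ∂μ := by
  have hm : Measurable (fun p : X × ℝ => g (p.2 +ᵥ p.1)) := by fun_prop
  rw [lintegral_lintegral_swap hm.aemeasurable]
  have : ∀ t : ℝ, ∫⁻ x, g (t +ᵥ x) ∂μ = ∫⁻ x, g x ∂μ := fun t =>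
    (measurePreserving_vadd t μ).lintegral_comp hg
  simp [this, mul_comm]

/-- A property that holds at almost every time along almost every orbit holds almost everywhere. -/
theorem ae_of_ae_ae_vadd (μ : Measure X) [SFinite μ] [VAddInvariantMeasure ℝ X μ]
    {B : Set X} (hB : MeasurableSet B) (h : ∀ᵐ x ∂μ, ∀ᵐ t : ℝ, t +ᵥ x ∉ B) : μ B = 0 := by
  have key := lintegral_setLIntegral_vadd μ (measurable_one.indicator hB) (Icc (0 : ℝ) 1)
  rw [lintegral_indicator_one hB, Real.volume_Icc] at key
  have h0 : ∫⁻ x, (∫⁻ t in Icc (0 : ℝ) 1, B.indicator (1 : X → ℝ≥0∞) (t +ᵥ x)) ∂μ = 0 := by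
    rw [← lintegral_zero (μ := μ)]
    refine lintegral_congr_ae ?_
    filter_upwards [h] with x hx
    rw [← lintegral_zero (μ := volume.restrict (Icc (0 : ℝ) 1))]
    refine lintegral_congr_ae (ae_restrict_of_ae ?_)
    filter_upwards [hx] with t ht
    simp [ht]
  rw [h0] at key
  simpa using key.symm

/-- Along almost every orbit, a property that holds almost everywhere holds at almost every time. -/
theorem ae_ae_vadd_of_ae (μ : Measure X) [SFinite μ] [VAddInvariantMeasure ℝ X μ]
    {p : X → Prop} (h : ∀ᵐ x ∂μ, p x) : ∀ᵐ x ∂μ, ∀ᵐ t : ℝ, p (t +ᵥ x) := by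
  obtain ⟨D, hDsub, hDm, hD0⟩ := exists_measurable_superset_of_null (ae_iff.1 h)
  have key := lintegral_setLIntegral_vadd μ (measurable_one.indicator hDm) univ
  rw [lintegral_indicator_one hDm, hD0, mul_zero, lintegral_eq_zero_iff] at key
  · filter_upwards [key] with x hx
    simp only [Pi.zero_apply, Measure.restrict_univ] at hx
    rw [lintegral_eq_zero_iff] at hx
    · filter_upwards [hx] with t ht
      by_contra hp
      have : t +ᵥ x ∈ D := hDsub hp
      simp [this] at ht
    · exact (measurable_one.indicator hDm).comp (by fun_prop)
  · have hm : Measurable (fun p : X × ℝ => D.indicator (1 : X → ℝ≥0∞) (p.2 +ᵥ p.1)) :=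
      (measurable_one.indicator hDm).comp (by fun_prop)
    exact hm.lintegral_prod_right

end Fubini

section Cocycle

variable {f : X → ℝ} {x : X}

theorem flowIntegral_add (hf : LocallyIntegrable (fun s : ℝ => f (s +ᵥ x)) volume) (t s : ℝ) :
    flowIntegral f (t + s) x = flowIntegral f t x + flowIntegral f s (t +ᵥ x) := by
  have hi : ∀ a b : ℝ, IntervalIntegrable (fun s : ℝ => f (s +ᵥ x)) volume a b := fun a b =>
    hf.intervalIntegrable_real _ _
  unfold flowIntegral
  simp only [vadd_vadd]
  rw [intervalIntegral.integral_comp_add_right (fun u => f (u +ᵥ x)) t, zero_add, add_comm s t,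
    intervalIntegral.integral_add_adjacent_intervals (hi _ _) (hi _ _)]

theorem continuous_flowIntegral (hf : LocallyIntegrable (fun s : ℝ => f (s +ᵥ x)) volume) :
    Continuous fun t => flowIntegral f t x :=
  intervalIntegral.continuous_primitive (fun _ _ => hf.intervalIntegrable_real _ _) 0

theorem measurable_flowIntegral [MeasurableSpace X] [MeasurableVAdd₂ ℝ X] (hf : Measurable f) (t : ℝ) :
    Measurable fun x => flowIntegral f t x := by
  have hm : StronglyMeasurable (fun p : X × ℝ => f (p.2 +ᵥ p.1)) :=
    (hf.comp (by fun_prop)).stronglyMeasurable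
  have h1 : ∀ a b : ℝ, Measurable fun x => ∫ s in Ioc a b, f (s +ᵥ x) := fun a b =>
    (hm.integral_prod_right (ν := volume.restrict (Ioc a b))).measurable
  exact (h1 _ _).sub (h1 _ _)

end Cocycle

end Flow

/-! ### Density of functions with bounded orbit integrals. -/

section Approx

variable {X : Type*} [MeasurableSpace X] [AddAction ℝ X]

/-- Bounded measurable functions whose integrals along the orbits of the flow are uniformly
bounded. -/
def BoundedFlowIntegral (c : X → ℝ) : Prop :=
  Measurable c ∧ (∃ K, ∀ x, |c x| ≤ K) ∧ ∃ C, ∀ (t : ℝ) x, |flowIntegral c t x| ≤ C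

theorem intervalIntegrable_orbit [MeasurableVAdd₂ ℝ X] {c : X → ℝ} (hc : Measurable c) {K : ℝ}
    (hK : ∀ x, |c x| ≤ K) (x : X) (a b : ℝ) :
    IntervalIntegrable (fun s : ℝ => c (s +ᵥ x)) volume a b := by
  have h1 : IntervalIntegrable (fun _ : ℝ => K) volume a b := intervalIntegrable_const
  have hm : Measurable fun s : ℝ => c (s +ᵥ x) := hc.comp (by fun_prop)
  refine h1.mono_fun hm.aestronglyMeasurable (ae_of_all _ fun s => ?_)
  beta_reduce
  rw [Real.norm_eq_abs, Real.norm_eq_abs]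
  exact (hK _).trans (le_abs_self K)

variable [MeasurableVAdd₂ ℝ X]

theorem BoundedFlowIntegral.add {c d : X → ℝ} (hc : BoundedFlowIntegral c)
    (hd : BoundedFlowIntegral d) : BoundedFlowIntegral (c + d) := by
  obtain ⟨hcm, ⟨K, hK⟩, C, hC⟩ := hc
  obtain ⟨hdm, ⟨K', hK'⟩, C', hC'⟩ := hd
  refine ⟨hcm.add hdm, ⟨K + K', fun x => (abs_add_le _ _).trans (add_le_add (hK x) (hK' x))⟩,
    C + C', fun t x => ?_⟩
  have : flowIntegral (c + d) t x = flowIntegral c t x + flowIntegral d t x :=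
    intervalIntegral.integral_add (intervalIntegrable_orbit hcm hK x _ _)
      (intervalIntegrable_orbit hdm hK' x _ _)
  rw [this]
  exact (abs_add_le _ _).trans (add_le_add (hC t x) (hC' t x))

omit [MeasurableVAdd₂ ℝ X] in
theorem BoundedFlowIntegral.smul {c : X → ℝ} (hc : BoundedFlowIntegral c) (r : ℝ) :
    BoundedFlowIntegral (r • c) := by
  obtain ⟨hcm, ⟨K, hK⟩, C, hC⟩ := hc
  refine ⟨hcm.const_smul r, ⟨|r| * K, fun x => ?_⟩, |r| * C, fun t x => ?_⟩
  · simp only [Pi.smul_apply, smul_eq_mul, abs_mul]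
    gcongr
    exact hK x
  · have : flowIntegral (r • c) t x = r * flowIntegral c t x :=
      intervalIntegral.integral_const_mul r _
    rw [this, abs_mul]
    gcongr
    exact hC t x

/-- The orbit integral of a coboundary telescopes: only two end pieces, each of length `|s|`,
survive. -/
theorem boundedFlowIntegral_sub_comp_vadd {g : X → ℝ} (hg : Measurable g) {K : ℝ}
    (hK : ∀ x, |g x| ≤ K) (s : ℝ) : BoundedFlowIntegral fun x => g x - g (s +ᵥ x) := by
  refine ⟨by fun_prop, ⟨K + K, fun x => (abs_sub _ _).trans (add_le_add (hK _) (hK _))⟩,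
    K * |s| + K * |s|, fun t x => ?_⟩
  have hi := fun a b => intervalIntegrable_orbit hg hK x a b
  have h1 : flowIntegral (fun x => g x - g (s +ᵥ x)) t x
      = (∫ u in (0 : ℝ)..s, g (u +ᵥ x)) - ∫ u in t..t + s, g (u +ᵥ x) := by
    unfold flowIntegral
    have h2 := fun u : ℝ => vadd_vadd s u x
    simp only [h2]
    rw [intervalIntegral.integral_sub (hi _ _),
      intervalIntegral.integral_comp_add_left (fun u => g (u +ᵥ x)) s, add_zero, add_comm s t,
      intervalIntegral.integral_interval_sub_interval_comm (hi _ _) (hi _ _) (hi _ _)]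
    have := (hi (s + 0) (s + t)).comp_add_left s
    simpa using this
  have hb : ∀ a b : ℝ, |∫ u in a..b, g (u +ᵥ x)| ≤ K * |b - a| := fun a b => by
    rw [← Real.norm_eq_abs]
    exact intervalIntegral.norm_integral_le_of_norm_le_const fun u _ => hK _
  rw [h1]
  refine (abs_sub _ _).trans (add_le_add ?_ ?_)
  · simpa using hb 0 s
  · simpa using hb t (t + s)

variable (μ : Measure X) [IsProbabilityMeasure μ]

/-- The subspace of `L²` of functions with uniformly bounded integrals along orbits. -/
def boundedFlowIntegralSubmodule : Submodule ℝ (Lp ℝ 2 μ) where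
  carrier := {u | ∃ c, BoundedFlowIntegral c ∧ u =ᵐ[μ] c}
  add_mem' := by
    rintro u v ⟨c, hc, hu⟩ ⟨d, hd, hv⟩
    exact ⟨c + d, hc.add hd, (Lp.coeFn_add u v).trans (hu.add hv)⟩
  zero_mem' := ⟨0, ⟨measurable_zero, ⟨0, by simp⟩, 0, by simp [flowIntegral]⟩, Lp.coeFn_zero _ _ _⟩
  smul_mem' := by
    rintro r u ⟨c, hc, hu⟩
    exact ⟨r • c, hc.smul r, (Lp.coeFn_smul r u).trans (hu.const_smul r)⟩

variable [ErgodicVAdd ℝ X μ]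

omit [MeasurableVAdd₂ ℝ X] [IsProbabilityMeasure μ] in
theorem ae_eq_const_of_forall_comp_vadd_ae_eq {h : X → ℝ} (hm : AEStronglyMeasurable h μ)
    (hinv : ∀ t : ℝ, (fun x => h (t +ᵥ x)) =ᵐ[μ] h) : ∃ k : ℝ, h =ᵐ[μ] fun _ => k := by
  refine exists_eventuallyEq_const_of_forall_separating MeasurableSet fun U hU => ?_
  have h1 : EventuallyConst (h ⁻¹' U) (ae μ) := by
    refine aeconst_of_forall_preimage_vadd_ae_eq ℝ
      (hm.aemeasurable.nullMeasurable hU) fun t => ?_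
    filter_upwards [hinv t] with x hx
    have : h (t +ᵥ x) = h x := hx
    change (h (t +ᵥ x) ∈ U) = (h x ∈ U)
    rw [this]
  exact eventuallyConst_set.1 h1

/-- Testing `h` against the coboundaries of indicator functions shows that its set integrals are
flow-invariant, so `h` is invariant and ergodicity applies. -/
theorem mem_orthogonal_boundedFlowIntegral {h : Lp ℝ 2 μ}
    (hh : h ∈ (boundedFlowIntegralSubmodule μ)ᗮ) : ∃ k : ℝ, h =ᵐ[μ] fun _ => k := by
  have hhi : Integrable h μ := (Lp.memLp h).integrable (by norm_num)
  have key : ∀ (t : ℝ) (A : Set X), MeasurableSet A →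
      ∫ x in A, h x ∂μ = ∫ x in (t +ᵥ ·) ⁻¹' A, h x ∂μ := by
    intro t A hA
    have hA' : MeasurableSet ((t +ᵥ ·) ⁻¹' A : Set X) := (measurable_const_vadd t) hA
    set g : X → ℝ := A.indicator 1
    have hg : Measurable g := measurable_one.indicator hA
    have hgK : ∀ x, |g x| ≤ 1 := fun x => by
      by_cases hx : x ∈ A <;> simp [g, hx]
    have hc := boundedFlowIntegral_sub_comp_vadd hg hgK t
    have hmem : MemLp (fun x => g x - g (t +ᵥ x)) 2 μ := by
      obtain ⟨K, hK⟩ := hc.2.1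
      exact MemLp.of_bound hc.1.aestronglyMeasurable K (ae_of_all _ hK)
    have h0 := hh (hmem.toLp _) ⟨_, hc, hmem.coeFn_toLp⟩
    rw [L2.inner_def] at h0
    have h1 : ∫ x, (A.indicator h x - ((t +ᵥ ·) ⁻¹' A).indicator h x) ∂μ = 0 := by
      rw [← h0]
      refine integral_congr_ae ?_
      filter_upwards [hmem.coeFn_toLp] with x hx
      rw [hx]
      by_cases h1 : x ∈ A <;> by_cases h2 : t +ᵥ x ∈ A <;> simp [g, h1, h2]
    rw [integral_sub (hhi.indicator hA) (hhi.indicator hA'), integral_indicator hA,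
      integral_indicator hA'] at h1
    linarith
  refine ae_eq_const_of_forall_comp_vadd_ae_eq μ (Lp.aestronglyMeasurable h) fun t => ?_
  have hmp := measurePreserving_vadd (α := X) t μ
  have hemb : MeasurableEmbedding (fun x : X => t +ᵥ x) := measurableEmbedding_const_vadd t
  refine (hmp.integrable_comp_of_integrable hhi).ae_eq_of_forall_setIntegral_eq _ _ hhi
    fun A hA _ => ?_
  have hA' : MeasurableSet ((-t +ᵥ ·) ⁻¹' A : Set X) := (measurable_const_vadd (-t)) hA
  have hpre : (fun x : X => t +ᵥ x) ⁻¹' ((fun x => -t +ᵥ x) ⁻¹' A) = A := by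
    ext x; simp
  rw [key (-t) A hA, ← hmp.setIntegral_preimage_emb hemb h ((fun x => -t +ᵥ x) ⁻¹' A), hpre]
  rfl

/-- A mean-zero `g` is orthogonal to constants, so it lies in the double orthogonal complement,
which is the closure. -/
theorem exists_boundedFlowIntegral_eLpNorm_two_lt {g : X → ℝ} (hg : MemLp g 2 μ)
    (hmean : ∫ x, g x ∂μ = 0) {ε : ℝ≥0∞} (hε : ε ≠ 0) :
    ∃ c, BoundedFlowIntegral c ∧ eLpNorm (g - c) 2 μ < ε := by
  have hmem : hg.toLp g ∈ (boundedFlowIntegralSubmodule μ).topologicalClosure := by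
    rw [← Submodule.orthogonal_orthogonal_eq_closure, Submodule.mem_orthogonal]
    intro h hh
    obtain ⟨k, hk⟩ := mem_orthogonal_boundedFlowIntegral μ hh
    rw [L2.inner_def]
    have : ∫ x, inner ℝ (h x) (hg.toLp g x) ∂μ = ∫ x, k * g x ∂μ := by
      refine integral_congr_ae ?_
      filter_upwards [hk, hg.coeFn_toLp] with x h1 h2
      rw [h1, h2]
      simp [mul_comm]
    rw [this, integral_const_mul, hmean, mul_zero]
  rw [← SetLike.mem_coe, Submodule.topologicalClosure_coe, EMetric.mem_closure_iff] at hmem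
  obtain ⟨u, ⟨c, hc, huc⟩, hu⟩ := hmem ε (pos_iff_ne_zero.2 hε)
  refine ⟨c, hc, ?_⟩
  rw [Lp.edist_def] at hu
  refine lt_of_eq_of_lt (eLpNorm_congr_ae ?_) hu
  exact hg.coeFn_toLp.symm.sub huc.symm

/-- An integrable function of mean zero is, up to a small error in `L¹`, a function with uniformly
bounded integrals along the orbits of an ergodic flow. -/
theorem exists_boundedFlowIntegral_lintegral_lt {f : X → ℝ} (hf : Integrable f μ)
    (hmean : ∫ x, f x ∂μ = 0) {ε : ℝ≥0∞} (hε : ε ≠ 0) :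
    ∃ c, BoundedFlowIntegral c ∧ ∫⁻ x, ‖f x - c x‖ₑ ∂μ < ε := by
  wlog hεtop : ε ≠ ∞ generalizing ε
  · obtain ⟨c, hc, h⟩ := this one_ne_zero ENNReal.one_ne_top
    exact ⟨c, hc, h.trans (by simp [not_not.1 hεtop])⟩
  have hδ : ε / 4 ≠ 0 := by simp [hε]
  obtain ⟨g, hfg, hg⟩ := (memLp_one_iff_integrable.2 hf).exists_simpleFunc_eLpNorm_sub_lt
    ENNReal.one_ne_top hδ
  have hgi : Integrable g μ := memLp_one_iff_integrable.1 hg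
  -- The simple function `g` need not have mean zero, but its mean is as small as the approximation
  -- error.
  set m := ∫ x, g x ∂μ
  have hm : ‖m‖ₑ < ε / 4 := by
    have h1 : m = -∫ x, (f x - g x) ∂μ := by
      rw [integral_sub hf hgi, hmean]; ring
    rw [h1, enorm_neg]
    refine (enorm_integral_le_lintegral_enorm _).trans_lt ?_
    rw [eLpNorm_one_eq_lintegral_enorm] at hfg
    exact hfg
  have hg2 : MemLp (fun x => g x - m) 2 μ :=
    (g.memLp_of_isFiniteMeasure 2 μ).sub (memLp_const m)
  obtain ⟨c, hc, hgc⟩ := exists_boundedFlowIntegral_eLpNorm_two_lt μ hg2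
    (by rw [integral_sub hgi (integrable_const m)]; simp [m]) hδ
  refine ⟨c, hc, ?_⟩
  have hgc1 : ∫⁻ x, ‖g x - m - c x‖ₑ ∂μ < ε / 4 := by
    refine lt_of_le_of_lt ?_ hgc
    rw [← eLpNorm_one_eq_lintegral_enorm]
    exact eLpNorm_le_eLpNorm_of_exponent_le (by norm_num)
      (hg2.aestronglyMeasurable.sub hc.1.aestronglyMeasurable)
  rw [eLpNorm_one_eq_lintegral_enorm] at hfg
  have hfgm : AEMeasurable (fun x => ‖f x - g x‖ₑ) μ :=
    (hf.sub hgi).aestronglyMeasurable.enorm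
  calc ∫⁻ x, ‖f x - c x‖ₑ ∂μ
      ≤ ∫⁻ x, (‖f x - g x‖ₑ + (‖m‖ₑ + ‖g x - m - c x‖ₑ)) ∂μ := by
        refine lintegral_mono fun x => ?_
        have : f x - c x = (f x - g x) + (m + (g x - m - c x)) := by ring
        rw [this]
        exact (enorm_add_le _ _).trans (add_le_add le_rfl (enorm_add_le _ _))
    _ = ∫⁻ x, ‖f x - g x‖ₑ ∂μ + (‖m‖ₑ + ∫⁻ x, ‖g x - m - c x‖ₑ ∂μ) := by
        rw [lintegral_add_left' hfgm, lintegral_add_left measurable_const]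
        simp
    _ < ε / 4 + (ε / 4 + ε / 4) :=
        ENNReal.add_lt_add hfg (ENNReal.add_lt_add hm hgc1)
    _ ≤ ε / 4 + (ε / 4 + ε / 4) + ε / 4 := le_self_add
    _ = ε := by
        have h4 : ε / 4 * 4 = ε := ENNReal.div_mul_cancel (by norm_num) (by norm_num)
        calc _ = ε / 4 * 4 := by ring
          _ = ε := h4

end Approx

/-! ### Returns at zeros of the cocycle. -/

section Recurrence

variable {X : Type*} [MeasurableSpace X] [AddAction ℝ X] [MeasurableVAdd₂ ℝ X]
  {f : X → ℝ}

theorem enorm_flowIntegral_le (hloc : ∀ x, LocallyIntegrable (fun s : ℝ => f (s +ᵥ x)) volume)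
    {c : X → ℝ} (hc : BoundedFlowIntegral c) {C : ℝ} (hC : ∀ (t : ℝ) x, |flowIntegral c t x| ≤ C)
    {t L : ℝ} (ht : t ∈ Icc 0 L) (x : X) :
    ‖flowIntegral f t x‖ₑ
      ≤ ENNReal.ofReal C + ∫⁻ s in Icc 0 L, ‖f (s +ᵥ x) - c (s +ᵥ x)‖ₑ := by
  obtain ⟨K, hK⟩ := hc.2.1
  have hci := intervalIntegrable_orbit hc.1 hK x 0 t
  have hfi := (hloc x).intervalIntegrable_real 0 t
  have h1 : flowIntegral f t x
      = flowIntegral c t x + ∫ s in (0 : ℝ)..t, (f (s +ᵥ x) - c (s +ᵥ x)) := by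
    rw [intervalIntegral.integral_sub hfi hci]
    simp [flowIntegral]
  rw [h1]
  refine (enorm_add_le _ _).trans (add_le_add ?_ ?_)
  · rw [Real.enorm_eq_ofReal_abs]
    exact ENNReal.ofReal_le_ofReal (hC t x)
  · rw [intervalIntegral.integral_of_le ht.1]
    refine (enorm_integral_le_lintegral_enorm _).trans (lintegral_mono_set ?_)
    exact Ioc_subset_Icc_self.trans (Icc_subset_Icc le_rfl ht.2)

/-- For a mean zero function `f`, a set whose points return to it at zeros of the integral of `f`
only during a bounded time interval `[ε, N]` has `|f| μ`-measure zero. -/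
theorem setLIntegral_enorm_eq_zero_of_no_return (μ : Measure X) [IsProbabilityMeasure μ]
    [ErgodicVAdd ℝ X μ] (hfm : Measurable f) (hf : Integrable f μ) (hmean : ∫ x, f x ∂μ = 0)
    (hloc : ∀ x, LocallyIntegrable (fun s : ℝ => f (s +ᵥ x)) volume)
    {B : Set X} (hB : MeasurableSet B) {ε N : ℝ} (hε : 0 < ε) (hN : 0 ≤ N)
    (H : ∀ x ∈ B, ∀ t : ℝ, 0 < t → t +ᵥ x ∈ B → flowIntegral f t x = 0 → ε ≤ t ∧ t ≤ N) :
    ∫⁻ x in B, ‖f x‖ₑ ∂μ = 0 := by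
  set I := ∫⁻ x in B, ‖f x‖ₑ ∂μ with hI
  have hItop : I ≠ ∞ := ((setLIntegral_le_lintegral _ _).trans_lt hf.2).ne
  by_contra hI0
  have hi : 0 < I.toReal := ENNReal.toReal_pos hI0 hItop
  set K := N + ε with hK
  have hK0 : 0 < K := by positivity
  -- With this tolerance `main` reads `n ε I ≤ 2 C + n ε I / 2`, which fails once `n > 4 C / (ε I)`.
  obtain ⟨c, hc, hfc⟩ := exists_boundedFlowIntegral_lintegral_lt μ hf hmean
    (ε := ENNReal.ofReal (ε * I.toReal / (4 * K))) (by simpa using by positivity)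
  obtain ⟨C, hC⟩ := hc.2.2
  have hC0 : 0 ≤ C := by
    obtain ⟨x⟩ : Nonempty X := nonempty_of_isProbabilityMeasure μ
    exact (abs_nonneg _).trans (hC 0 x)
  have main : ∀ n : ℕ, n * ENNReal.ofReal ε * I ≤ 2 * (ENNReal.ofReal C
      + ENNReal.ofReal (n * K) * ENNReal.ofReal (ε * I.toReal / (4 * K))) := by
    intro n
    set E : Set ℝ := ⋃ i ∈ Finset.range n, Ico (i * K) (i * K + ε) with hE
    have hEm : MeasurableSet E := Finset.measurableSet_biUnion _ fun i _ => measurableSet_Ico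
    have hsep : ∀ i j : ℕ, i < j → (i : ℝ) * K + K ≤ j * K := by
      intro i j hij
      have : (i : ℝ) + 1 ≤ j := by exact_mod_cast hij
      nlinarith
    have hEvol : volume E = n * ENNReal.ofReal ε := by
      rw [hE, measure_biUnion_finset]
      · simp
      · intro i _ j _ hij
        rw [Function.onFun, Set.disjoint_left]
        rintro t ⟨h1, h2⟩ ⟨h3, h4⟩
        rcases lt_or_gt_of_ne hij with h | h
        · have := hsep i j h; linarith
        · have := hsep j i h; linarith
      · exact fun i _ => measurableSet_Ico
    have hEL : E ⊆ Icc 0 (n * K) := by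
      intro t ht
      simp only [hE, Finset.mem_range, mem_iUnion, exists_prop] at ht
      obtain ⟨i, hin, h1, h2⟩ := ht
      have := hsep i n hin
      exact ⟨le_trans (by positivity) h1, by linarith⟩
    have hgm : Measurable (B.indicator fun x => ‖f x‖ₑ) := hfm.enorm.indicator hB
    have key := lintegral_setLIntegral_vadd μ hgm E
    rw [lintegral_indicator hB, hEvol] at key
    rw [hI, ← key]
    have hdm : Measurable fun x => ‖f x - c x‖ₑ := (hfm.sub hc.1).enorm
    calc ∫⁻ x, (∫⁻ t in E, B.indicator (fun x => ‖f x‖ₑ) (t +ᵥ x)) ∂μ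
        ≤ ∫⁻ x, 2 * (ENNReal.ofReal C
            + ∫⁻ s in Icc 0 (n * K), ‖f (s +ᵥ x) - c (s +ᵥ x)‖ₑ) ∂μ := by
          refine lintegral_mono fun x => ?_
          have hBx : MeasurableSet ((fun t : ℝ => t +ᵥ x) ⁻¹' B) :=
            (show Measurable fun t : ℝ => t +ᵥ x by fun_prop) hB
          have h1 : ∀ t : ℝ, B.indicator (fun x => ‖f x‖ₑ) (t +ᵥ x)
              = ((fun t : ℝ => t +ᵥ x) ⁻¹' B).indicator (fun t => ‖f (t +ᵥ x)‖ₑ) t :=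
            fun t => rfl
          simp only [h1]
          rw [setLIntegral_indicator hBx]
          refine setLIntegral_enorm_le_of_injOn_primitive (hloc x) (hBx.inter hEm) ?_
            fun t ht => enorm_flowIntegral_le hloc hc hC (hEL ht.2) x
          -- Equal values would make `t₂ - t₁` a return time in `[ε, N]`, which the spacing of `E`
          -- excludes both within one window and between two.
          have hne : ∀ t₁ t₂ : ℝ, t₁ < t₂ → t₁ +ᵥ x ∈ B → t₂ +ᵥ x ∈ B → t₁ ∈ E → t₂ ∈ E →
              flowIntegral f t₁ x ≠ flowIntegral f t₂ x := by
            intro t₁ t₂ hlt hb₁ hb₂ he₁ he₂ heq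
            have hadd := flowIntegral_add (hloc x) t₁ (t₂ - t₁)
            rw [add_sub_cancel, heq] at hadd
            obtain ⟨h1, h2⟩ := H (t₁ +ᵥ x) hb₁ (t₂ - t₁) (sub_pos.2 hlt)
              (by rwa [vadd_vadd, sub_add_cancel]) (by linarith)
            simp only [hE, Finset.mem_range, mem_iUnion, exists_prop] at he₁ he₂
            obtain ⟨i, -, hi1, hi2⟩ := he₁
            obtain ⟨j, -, hj1, hj2⟩ := he₂
            rcases lt_trichotomy i j with h | rfl | h
            · have := hsep i j h; linarith
            · linarith
            · have := hsep j i h; linarith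
          intro t₁ h₁ t₂ h₂ heq
          rcases lt_trichotomy t₁ t₂ with h | h | h
          · exact absurd heq (hne t₁ t₂ h h₁.1 h₂.1 h₁.2 h₂.2)
          · exact h
          · exact absurd heq.symm (hne t₂ t₁ h h₂.1 h₁.1 h₂.2 h₁.2)
      _ = 2 * (ENNReal.ofReal C + ENNReal.ofReal (n * K) * ∫⁻ x, ‖f x - c x‖ₑ ∂μ) := by
          rw [lintegral_const_mul' _ _ (by norm_num), lintegral_add_left measurable_const,
            lintegral_setLIntegral_vadd μ hdm]
          simp
      _ ≤ _ := by gcongr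
  obtain ⟨n, hn⟩ := exists_nat_gt (4 * C / (ε * I.toReal))
  have h := ENNReal.toReal_mono (by finiteness) (main n)
  have hr : 0 ≤ ε * I.toReal / (4 * K) := by positivity
  have hr' : (0 : ℝ) ≤ n * K := by positivity
  rw [ENNReal.toReal_mul, ENNReal.toReal_mul, ENNReal.toReal_mul, ENNReal.toReal_add (by finiteness)
    (by finiteness), ENNReal.toReal_mul, ENNReal.toReal_ofReal hε.le, ENNReal.toReal_ofReal hC0,
    ENNReal.toReal_ofReal hr, ENNReal.toReal_ofReal hr'] at h
  simp only [ENNReal.toReal_natCast, ENNReal.toReal_ofNat] at h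
  have h2 : (n * K) * (ε * I.toReal / (4 * K)) = n * (ε * I.toReal) / 4 := by
    field_simp
  rw [h2] at h
  rw [div_lt_iff₀ (by positivity)] at hn
  linarith

/-- By continuity and compactness, a zero exists iff `|σ|` takes arbitrarily small values at
rational times. A one-point interval may contain no rational and is treated apart. -/
theorem measurableSet_exists_flowIntegral_eq_zero (hfm : Measurable f)
    (hloc : ∀ x, LocallyIntegrable (fun s : ℝ => f (s +ᵥ x)) volume) (a b : ℝ) :
    MeasurableSet {x | ∃ t ∈ Icc a b, flowIntegral f t x = 0} := by
  rcases lt_trichotomy a b with hab | rfl | hab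
  · have hset : {x | ∃ t ∈ Icc a b, flowIntegral f t x = 0} =
        ⋂ k : ℕ, ⋃ q : ℚ, ⋃ _ : (q : ℝ) ∈ Icc a b, {x | |flowIntegral f q x| < 1 / (k + 1)} := by
      ext x
      have hcont := (continuous_flowIntegral (hloc x)).abs
      simp only [mem_ofPred_eq, mem_iInter, mem_iUnion, exists_prop]
      constructor
      · rintro ⟨t, ht, h0⟩ k
        have hO : IsOpen {s | |flowIntegral f s x| < 1 / ((k : ℝ) + 1)} :=
          isOpen_lt hcont continuous_const
        have htO : t ∈ {s | |flowIntegral f s x| < 1 / ((k : ℝ) + 1)} := by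
          simp only [mem_ofPred_eq, h0, abs_zero]
          positivity
        rw [← closure_Ioo hab.ne] at ht
        obtain ⟨_, ⟨hsO, hsI⟩, q, rfl⟩ := Rat.denseRange_cast.inter_open_nonempty _
          (hO.inter isOpen_Ioo) (mem_closure_iff.1 ht _ hO htO)
        exact ⟨q, Ioo_subset_Icc_self hsI, hsO⟩
      · intro h
        obtain ⟨t, ht, hmin⟩ := isCompact_Icc.exists_isMinOn (nonempty_Icc.2 hab.le)
          hcont.continuousOn
        refine ⟨t, ht, abs_eq_zero.1 (le_antisymm ?_ (abs_nonneg _))⟩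
        refine le_of_forall_pos_le_add fun δ hδ => ?_
        obtain ⟨k, hk⟩ := exists_nat_one_div_lt hδ
        obtain ⟨q, hq, hlt⟩ := h k
        have : |flowIntegral f t x| ≤ |flowIntegral f q x| := hmin hq
        linarith
    rw [hset]
    refine MeasurableSet.iInter fun k => MeasurableSet.iUnion fun q =>
      MeasurableSet.iUnion fun _ => ?_
    exact measurableSet_lt (measurable_flowIntegral hfm _).abs measurable_const
  · simp only [Icc_self, mem_singleton_iff, exists_eq_left]
    exact measurable_flowIntegral hfm _ (measurableSet_singleton 0)
  · simp [Icc_eq_empty hab.not_ge]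

/-- The first zero of `t ↦ σ(t, x)` in the interval `[a, b]`. -/
noncomputable def firstZero (f : X → ℝ) (a b : ℝ) (x : X) : ℝ :=
  sInf {t | t ∈ Icc a b ∧ flowIntegral f t x = 0}

omit [MeasurableSpace X] [MeasurableVAdd₂ ℝ X] in
theorem firstZero_mem (hloc : ∀ x, LocallyIntegrable (fun s : ℝ => f (s +ᵥ x)) volume)
    {a b : ℝ} {x : X} (h : ∃ t ∈ Icc a b, flowIntegral f t x = 0) :
    firstZero f a b x ∈ Icc a b ∧ flowIntegral f (firstZero f a b x) x = 0 := by
  have hc : IsCompact {t | t ∈ Icc a b ∧ flowIntegral f t x = 0} :=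
    isCompact_Icc.inter_right (isClosed_eq (continuous_flowIntegral (hloc x)) continuous_const)
  exact hc.sInf_mem h

omit [MeasurableSpace X] [MeasurableVAdd₂ ℝ X] in
theorem firstZero_le {a b t : ℝ} {x : X} (ht : t ∈ Icc a b) (h : flowIntegral f t x = 0) :
    firstZero f a b x ≤ t :=
  csInf_le ⟨a, fun _ hs => hs.1.1⟩ ⟨ht, h⟩

theorem measurable_firstZero (hfm : Measurable f)
    (hloc : ∀ x, LocallyIntegrable (fun s : ℝ => f (s +ᵥ x)) volume) (a b : ℝ) :
    Measurable (firstZero f a b) := by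
  refine measurable_of_Iic fun c => ?_
  set Z := {x | ∃ t ∈ Icc a b, flowIntegral f t x = 0}
  have hZ : MeasurableSet Z := measurableSet_exists_flowIntegral_eq_zero hfm hloc a b
  -- The last piece accounts for points without a zero in `[a, b]`, where `sInf ∅ = 0`.
  have : firstZero f a b ⁻¹' Iic c = {x | ∃ t ∈ Icc a (min b c), flowIntegral f t x = 0} ∪
      (Zᶜ ∩ {_x | 0 ≤ c}) := by
    ext x
    simp only [mem_preimage, mem_Iic, mem_union, mem_inter_iff, mem_compl_iff, mem_ofPred_eq]
    by_cases hx : x ∈ Z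
    · have h1 := firstZero_mem hloc hx
      simp only [hx, not_true_eq_false, false_and, or_false]
      constructor
      · exact fun h => ⟨_, ⟨h1.1.1, le_min h1.1.2 h⟩, h1.2⟩
      · rintro ⟨t, ht, h0⟩
        exact (firstZero_le ⟨ht.1, ht.2.trans (min_le_left _ _)⟩ h0).trans
          (ht.2.trans (min_le_right _ _))
    · have h1 : {t | t ∈ Icc a b ∧ flowIntegral f t x = 0} = ∅ := by
        ext t
        simp only [mem_ofPred_eq, mem_empty_iff_false, iff_false]
        exact fun h => hx ⟨t, h.1, h.2⟩
      have h2 : ¬∃ t ∈ Icc a (min b c), flowIntegral f t x = 0 := by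
        rintro ⟨t, ht, h0⟩
        exact hx ⟨t, ⟨ht.1, ht.2.trans (min_le_left _ _)⟩, h0⟩
      rw [firstZero, h1, Real.sInf_empty]
      simp only [h2, hx, not_false_eq_true, true_and, false_or]
  rw [this]
  exact (measurableSet_exists_flowIntegral_eq_zero hfm hloc _ _).union
    (hZ.compl.inter (MeasurableSet.const _))

/-- Points whose integral along the orbit does not vanish at the times in `[-ε, 0)`. -/
def noPastZero (f : X → ℝ) (ε : ℝ) : Set X :=
  {x | ∀ s : ℝ, -ε ≤ s → s < 0 → flowIntegral f s x ≠ 0}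

theorem measurableSet_noPastZero (hfm : Measurable f)
    (hloc : ∀ x, LocallyIntegrable (fun s : ℝ => f (s +ᵥ x)) volume) (ε : ℝ) :
    MeasurableSet (noPastZero f ε) := by
  have : noPastZero f ε
      = ⋂ k : ℕ, {x | ∃ t ∈ Icc (-ε) (-(1 / ((k : ℝ) + 1))), flowIntegral f t x = 0}ᶜ := by
    ext x
    simp only [noPastZero, mem_ofPred_eq, mem_iInter, mem_compl_iff, not_exists, not_and]
    constructor
    · intro h k t ht
      have : 0 < 1 / ((k : ℝ) + 1) := by positivity
      exact h t ht.1 (by linarith [ht.2])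
    · intro h s hs hs0
      obtain ⟨k, hk⟩ := exists_nat_one_div_lt (neg_pos.2 hs0)
      exact h k s ⟨hs, by linarith⟩
  rw [this]
  exact MeasurableSet.iInter fun k =>
    (measurableSet_exists_flowIntegral_eq_zero hfm hloc _ _).compl

theorem ae_exists_mem_noPastZero (μ : Measure X) [SFinite μ] [VAddInvariantMeasure ℝ X μ]
    (hfm : Measurable f) (hloc : ∀ x, LocallyIntegrable (fun s : ℝ => f (s +ᵥ x)) volume) :
    ∀ᵐ x ∂μ, f x ≠ 0 → ∃ n : ℕ, x ∈ noPastZero f (1 / ((n : ℝ) + 1)) := by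
  have hset : {x | ¬(f x ≠ 0 → ∃ n : ℕ, x ∈ noPastZero f (1 / ((n : ℝ) + 1)))}
      = (f ⁻¹' {0})ᶜ ∩ ⋂ n : ℕ, (noPastZero f (1 / ((n : ℝ) + 1)))ᶜ := by
    ext x
    simp
  rw [ae_iff, hset]
  refine ae_of_ae_ae_vadd μ ?_ (ae_of_all _ fun x => ?_)
  · exact (hfm (measurableSet_singleton 0)).compl.inter
      (MeasurableSet.iInter fun n => (measurableSet_noPastZero hfm hloc _).compl)
  filter_upwards [LocallyIntegrable.ae_hasDerivAt_integral (hloc x)] with t ht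
  rintro ⟨hft, hn⟩
  -- The derivative of `σ` at `t` is `f (t +ᵥ x) ≠ 0`, so the value at `t` is not repeated nearby.
  have hev := (ht 0).eventually_ne (c := flowIntegral f t x) hft
  rw [eventually_nhdsWithin_iff, Metric.eventually_nhds_iff] at hev
  obtain ⟨δ, hδ, hev⟩ := hev
  obtain ⟨n, hnδ⟩ := exists_nat_one_div_lt hδ
  refine mem_iInter.1 hn n fun s hs hs0 h0 => ?_
  refine hev (y := t + s) ?_ (by simp [hs0.ne]) ?_
  · rw [Real.dist_eq, add_sub_cancel_left, abs_of_neg hs0]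
    linarith
  · have := flowIntegral_add (hloc x) t s
    rw [h0, add_zero] at this
    exact this

/-- Almost every point of a measurable set `U` with `f x ≠ 0` returns to `U` at arbitrarily large
zeros of the integral of `f` along its orbit. -/
theorem ae_exists_return (μ : Measure X) [IsProbabilityMeasure μ]
    [ErgodicVAdd ℝ X μ] (hfm : Measurable f) (hf : Integrable f μ) (hmean : ∫ x, f x ∂μ = 0)
    (hloc : ∀ x, LocallyIntegrable (fun s : ℝ => f (s +ᵥ x)) volume)
    {U : Set X} (hU : MeasurableSet U) {N : ℝ} (hN : 0 ≤ N) :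
    ∀ᵐ x ∂μ, x ∈ U → f x ≠ 0 → ∃ t : ℝ, N ≤ t ∧ flowIntegral f t x = 0 ∧ t +ᵥ x ∈ U := by
  -- Quantifying over all late zeros would be uncountable; first zeros in rational intervals are
  -- measurable in `x` and there are countably many.
  set R : ℚ → ℚ → Set X := fun a b =>
    {x | ∃ t ∈ Icc (a : ℝ) b, flowIntegral f t x = 0} ∩
      (fun x => firstZero f a b x +ᵥ x) ⁻¹' U with hR
  have hRm : ∀ a b, MeasurableSet (R a b) := fun a b => by
    have := measurable_firstZero hfm hloc a b
    refine (measurableSet_exists_flowIntegral_eq_zero hfm hloc _ _).inter ?_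
    exact (show Measurable fun x => firstZero f a b x +ᵥ x from this.vadd measurable_id) hU
  set B : ℕ → Set X := fun n => (U ∩ noPastZero f (1 / ((n : ℝ) + 1))) ∩
    ⋂ a : ℚ, ⋂ _ : N ≤ a, ⋂ b : ℚ, (R a b)ᶜ with hBdef
  have hBm : ∀ n, MeasurableSet (B n) := fun n =>
    (hU.inter (measurableSet_noPastZero hfm hloc _)).inter
      (MeasurableSet.iInter fun a => MeasurableSet.iInter fun _ => MeasurableSet.iInter fun b =>
        (hRm a b).compl)
  have hB0 : ∀ n, ∀ᵐ x ∂μ, x ∈ B n → f x = 0 := by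
    intro n
    have hε : 0 < 1 / ((n : ℝ) + 1) := by positivity
    have h0 := setLIntegral_enorm_eq_zero_of_no_return μ hfm hf hmean hloc (hBm n) hε hN ?_
    · rw [setLIntegral_eq_zero_iff (hBm n) hfm.enorm] at h0
      simpa using h0
    intro x hx t ht htx hzero
    have hpast : ∀ s : ℝ, t - 1 / ((n : ℝ) + 1) ≤ s → s < t → flowIntegral f s x ≠ 0 := by
      intro s hs hst h0
      have hadd := flowIntegral_add (hloc x) t (s - t)
      rw [add_sub_cancel, hzero, h0, zero_add] at hadd
      exact htx.1.2 (s - t) (by linarith) (by linarith) hadd.symm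
    constructor
    · by_contra! hlt
      exact hpast 0 (by linarith) ht (by simp [flowIntegral])
    · by_contra! hlt
      -- As there is no zero in `[t - 1/(n+1), t)`, starting the interval at such an `a` makes `t`
      -- its first zero.
      obtain ⟨a, ha1, ha2⟩ := exists_rat_btwn (max_lt hlt (sub_lt_self t hε))
      obtain ⟨b, hb⟩ := exists_rat_gt t
      have htI : t ∈ Icc (a : ℝ) b := ⟨ha2.le, hb.le⟩
      have hmem := firstZero_mem hloc ⟨t, htI, hzero⟩
      have hτ : firstZero f a b x = t := by
        refine le_antisymm (firstZero_le htI hzero) ?_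
        by_contra! h
        refine hpast _ ?_ h hmem.2
        exact (le_max_right _ _).trans (ha1.le.trans hmem.1.1)
      have hxR : x ∈ R a b := by
        refine ⟨⟨t, htI, hzero⟩, ?_⟩
        rw [mem_preimage, hτ]
        exact htx.1.1
      have hNa : N ≤ a := (le_max_left _ _).trans ha1.le
      have := hx.2
      simp only [mem_iInter] at this
      exact this a hNa b hxR
  filter_upwards [ae_all_iff.2 hB0, ae_exists_mem_noPastZero μ hfm hloc] with x hx hpast hxU hfx
  obtain ⟨n, hn⟩ := hpast hfx
  have hxB : x ∉ B n := fun h => hfx (hx n h)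
  have : ∃ a : ℚ, N ≤ a ∧ ∃ b : ℚ, x ∈ R a b := by
    by_contra! hcon
    refine hxB ⟨⟨hxU, hn⟩, ?_⟩
    simp only [mem_iInter]
    exact hcon
  obtain ⟨a, hNa, b, hz, hret⟩ := this
  have hmem := firstZero_mem hloc hz
  exact ⟨firstZero f a b x, hNa.trans hmem.1.1, hmem.2, hret⟩

end Recurrence

/-- A metric space carrying a finite measure that is positive on nonempty open sets is second
countable. -/
theorem secondCountableTopology_of_forall_isOpen_measure_pos {X : Type*} [MetricSpace X]
    [MeasurableSpace X] [OpensMeasurableSpace X] (μ : Measure X) [IsFiniteMeasure μ]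
    (hopen : ∀ U : Set X, IsOpen U → U.Nonempty → 0 < μ U) : SecondCountableTopology X := by
  refine Metric.secondCountable_of_almost_dense_set fun ε hε => ?_
  -- A maximal `ε`-separated set is `ε`-dense. It is countable because the disjoint balls of radius
  -- `ε / 2` around it all have positive measure.
  obtain ⟨S, hS⟩ := zorn_subset {N : Set X | N.Pairwise fun x y => ε < dist x y} (by
    refine fun c hc hchain => ⟨⋃₀ c, ?_, fun s hs => subset_sUnion_of_mem hs⟩
    exact (pairwise_sUnion hchain.directedOn).2 fun s hs => hc hs)
  refine ⟨S, ?_, fun x => ?_⟩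
  · have hdisj : Pairwise (Function.onFun Disjoint fun x : S => Metric.ball (x : X) (ε / 2)) := by
      intro x y hxy
      refine Metric.ball_disjoint_ball ?_
      have : ε < dist (x : X) y := hS.1 x.2 y.2 (Subtype.coe_injective.ne hxy)
      linarith
    have hcount := Measure.countable_meas_pos_of_disjoint_iUnion (μ := μ)
      (fun x : S => (Metric.isOpen_ball (x := (x : X)) (ε := ε / 2)).measurableSet) hdisj
    have huniv : {x : S | 0 < μ (Metric.ball (x : X) (ε / 2))} = univ :=
      eq_univ_of_forall fun x => hopen _ Metric.isOpen_ball (Metric.nonempty_ball.2 (half_pos hε))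
    rw [huniv, countable_univ_iff] at hcount
    exact hcount
  · by_contra! hx
    have hins : insert x S ∈ {N : Set X | N.Pairwise fun x y => ε < dist x y} := by
      refine hS.1.insert fun y hy _ => ⟨hx y hy, ?_⟩
      rw [dist_comm]
      exact hx y hy
    have hxS : x ∈ S := hS.2 hins (subset_insert x S) (mem_insert x S)
    have := hx x hxS
    rw [dist_self] at this
    linarith

/-! ### Reduction to a measurable function integrable along every orbit. -/

section Orbits

variable {X : Type*} [AddAction ℝ X]

/-- Points along whose orbit `f` is integrable on bounded time intervals. -/
def integrableOrbits (f : X → ℝ) : Set X :=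
  {x | ∀ a b : ℝ, IntervalIntegrable (fun s : ℝ => f (s +ᵥ x)) volume a b}

theorem vadd_mem_integrableOrbits {f : X → ℝ} {x : X} (hx : x ∈ integrableOrbits f) (t : ℝ) :
    t +ᵥ x ∈ integrableOrbits f := by
  intro a b
  simp only [vadd_vadd]
  simpa using (hx (a + t) (b + t)).comp_add_right t

theorem measurableSet_integrableOrbits [MeasurableSpace X] [MeasurableVAdd₂ ℝ X] {f : X → ℝ}
    (hf : Measurable f) : MeasurableSet (integrableOrbits f) := by
  have hset : integrableOrbits f
      = ⋂ n : ℕ, {x | ∫⁻ s in Ioc (-(n : ℝ)) n, ‖f (s +ᵥ x)‖ₑ < ∞} := by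
    ext x
    have hm : Measurable fun s : ℝ => f (s +ᵥ x) := hf.comp (by fun_prop)
    simp only [mem_iInter]
    constructor
    · intro h n
      exact (h (-n) n).1.2
    · intro h a b
      obtain ⟨n, hn⟩ := exists_nat_gt (max |a| |b|)
      have ha := abs_lt.1 ((le_max_left _ _).trans_lt hn)
      have hb := abs_lt.1 ((le_max_right _ _).trans_lt hn)
      have h1 : IntegrableOn (fun s : ℝ => f (s +ᵥ x)) (Ioc (-(n : ℝ)) n) :=
        ⟨hm.aestronglyMeasurable, h n⟩
      exact ⟨h1.mono_set (Ioc_subset_Ioc ha.1.le hb.2.le),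
        h1.mono_set (Ioc_subset_Ioc hb.1.le ha.2.le)⟩
  rw [hset]
  refine MeasurableSet.iInter fun n => ?_
  have hm : Measurable (fun p : X × ℝ => ‖f (p.2 +ᵥ p.1)‖ₑ) :=
    hf.enorm.comp (f := fun p : X × ℝ => p.2 +ᵥ p.1) (by fun_prop)
  exact measurableSet_lt hm.lintegral_prod_right measurable_const

/-- The set is flow-invariant, so cutting off outside it keeps an orbit function whole or replaces
it by zero. -/
theorem locallyIntegrable_indicator_integrableOrbits (f : X → ℝ) (x : X) :
    LocallyIntegrable (fun s : ℝ => (integrableOrbits f).indicator f (s +ᵥ x)) volume := by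
  by_cases hx : x ∈ integrableOrbits f
  · have : (fun s : ℝ => (integrableOrbits f).indicator f (s +ᵥ x)) = fun s => f (s +ᵥ x) :=
      funext fun s => indicator_of_mem (vadd_mem_integrableOrbits hx s) f
    rw [this]
    intro u
    refine ⟨Ioc (u - 1) (u + 1), Ioc_mem_nhds (by linarith) (by linarith), (hx _ _).1⟩
  · have : (fun s : ℝ => (integrableOrbits f).indicator f (s +ᵥ x)) = fun s => 0 := by
      refine funext fun s => indicator_of_notMem (fun h => hx ?_) f
      simpa using vadd_mem_integrableOrbits h (-s)
    rw [this]
    exact locallyIntegrable_zero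

end Orbits

theorem ae_exists_recurrence_of_measurable {X : Type*} [MetricSpace X] [SecondCountableTopology X]
    [MeasurableSpace X] [OpensMeasurableSpace X] [AddAction ℝ X] [MeasurableVAdd₂ ℝ X]
    (μ : Measure X) [IsProbabilityMeasure μ] [ErgodicVAdd ℝ X μ]
    {f : X → ℝ} (hfm : Measurable f) (hf : Integrable f μ) (hmean : ∫ x, f x ∂μ = 0)
    (hloc : ∀ x, LocallyIntegrable (fun s : ℝ => f (s +ᵥ x)) volume) :
    ∀ᵐ x ∂μ, f x ≠ 0 →
      ∃ t : ℕ → ℝ, Tendsto t atTop atTop ∧ (∀ k, flowIntegral f (t k) x = 0) ∧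
        Tendsto (fun k => t k +ᵥ x) atTop (𝓝 x) := by
  have : Nonempty X := nonempty_of_isProbabilityMeasure μ
  set d : ℕ → X := TopologicalSpace.denseSeq X
  have hret : ∀ᵐ x ∂μ, ∀ i k : ℕ, x ∈ Metric.ball (d i) (1 / ((k : ℝ) + 1)) → f x ≠ 0 →
      ∃ t : ℝ, (k : ℝ) ≤ t ∧ flowIntegral f t x = 0 ∧
        t +ᵥ x ∈ Metric.ball (d i) (1 / ((k : ℝ) + 1)) :=
    ae_all_iff.2 fun i => ae_all_iff.2 fun k =>
      ae_exists_return μ hfm hf hmean hloc Metric.isOpen_ball.measurableSet k.cast_nonneg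
  filter_upwards [hret] with x hx hfx
  have hex : ∀ k : ℕ, ∃ t : ℝ, (k : ℝ) ≤ t ∧ flowIntegral f t x = 0 ∧
      dist (t +ᵥ x) x ≤ 2 * (1 / ((k : ℝ) + 1)) := by
    intro k
    obtain ⟨i, hi⟩ := (TopologicalSpace.denseRange_denseSeq X).exists_dist_lt x
      (show (0 : ℝ) < 1 / ((k : ℝ) + 1) by positivity)
    obtain ⟨t, hkt, ht0, htd⟩ := hx i k hi hfx
    refine ⟨t, hkt, ht0, ?_⟩
    have h1 := dist_triangle (t +ᵥ x) (d i) x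
    rw [Metric.mem_ball] at htd
    rw [dist_comm] at hi
    linarith
  choose t hkt ht0 htd using hex
  refine ⟨t, tendsto_atTop_mono hkt tendsto_natCast_atTop_atTop, ht0, ?_⟩
  rw [tendsto_iff_dist_tendsto_zero]
  refine squeeze_zero (fun _ => dist_nonneg) htd ?_
  simpa using tendsto_one_div_add_atTop_nhds_zero_nat.const_mul (2 : ℝ)

theorem mainTheorem3 {X : Type*} [MetricSpace X] [MeasurableSpace X] [OpensMeasurableSpace X]
    [AddAction ℝ X] [MeasurableVAdd₂ ℝ X]
    (μ : Measure X) [IsProbabilityMeasure μ] [ErgodicVAdd ℝ X μ]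
    (hopen : ∀ U : Set X, IsOpen U → U.Nonempty → 0 < μ U)
    (f : X → ℝ) (hf : Integrable f μ) (hmean : ∫ x, f x ∂μ = 0)
    (hσ : ∀ᵐ x ∂μ, (∀ t : ℝ, IntervalIntegrable (fun s : ℝ => f (s +ᵥ x)) volume 0 t) ∧
      Continuous (fun t : ℝ => flowIntegral f t x)) :
    ∀ᵐ x ∂μ, f x ≠ 0 →
      ∃ t : ℕ → ℝ, Tendsto t atTop atTop ∧ (∀ k, flowIntegral f (t k) x = 0) ∧
        Tendsto (fun k => t k +ᵥ x) atTop (𝓝 x) := by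
  have := secondCountableTopology_of_forall_isOpen_measure_pos μ hopen
  set g : X → ℝ := hf.1.mk f
  have hgm : Measurable g := hf.1.stronglyMeasurable_mk.measurable
  have hfg : f =ᵐ[μ] g := hf.1.ae_eq_mk
  set h : X → ℝ := (integrableOrbits g).indicator g
  have hhm : Measurable h := hgm.indicator (measurableSet_integrableOrbits hgm)
  have horb : ∀ᵐ x ∂μ, x ∈ integrableOrbits g := by
    filter_upwards [hσ, ae_ae_vadd_of_ae μ hfg] with x hx hxg a b
    exact (((hx.1 a).symm.trans (hx.1 b))).congr_ae (ae_restrict_of_ae hxg)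
  have hfh : f =ᵐ[μ] h := by
    filter_upwards [hfg, horb] with x h1 h2
    rw [h1]
    exact (indicator_of_mem h2 g).symm
  -- Along almost every orbit `f` and `h` agree at almost every time, so their cocycles coincide
  -- there and have the same zeros.
  filter_upwards [ae_exists_recurrence_of_measurable μ hhm (hf.congr hfh)
    (by rw [← integral_congr_ae hfh, hmean]) (locallyIntegrable_indicator_integrableOrbits g),
    hfh, ae_ae_vadd_of_ae μ hfh] with x hx hxh hxorb hfx
  obtain ⟨t, ht, h0, hlim⟩ := hx (hxh ▸ hfx)
  refine ⟨t, ht, fun k => ?_, hlim⟩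
  rw [← h0 k]
  refine intervalIntegral.integral_congr_ae ?_
  filter_upwards [hxorb] with s hs _ using hs
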